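/- A (nonerasing) random context grammar is a quadruple $G=(N,T,P,S)$, where $N$ and $T$ are finite disjoint alphabets of nonterminals and terminals, $S\in N$, and $P$ is a finite set of productions $(A\to x,\mathit{Per},\mathit{For})$ with $A\in N$, $x\in (N\cup T)^+$ and $\mathit{Per},\mathit{For}\subseteq N$. For $u,v\in (N\cup T)^*$ and $(A\to x,\mathit{Per},\mathit{For})\in P$, one has $uAv\Rightarrow uxv$ provided that every symbol of $\mathit{Per}$ occurs in $uv$ and no symbol of $\mathit{For}$ occurs in $uv$. The language generated by $G$ is $L(G)=\{w\in T^* : S\Rightarrow^* w\}$, where $\Rightarrow^*$ is the reflexive and transitive closure of $\Rightarrow$. A random context language is a language generated by such a grammar. The grammar $G$ is called limited if every production in $P$ has one of the forms $(A\to BC,\mathit{Per},\mathit{For})$, $(A\to B,\mathit{Per},\mathit{For})$, $(A\to a,\emptyset,\emptyset)$ with $A,B,C\in N$ and $a\in T$, where each of the sets $\mathit{Per},\mathit{For}\subseteq N$ is either empty or a one-element set. **Corollary.** Every random context language $L\subseteq T^*$ is generated by a limited (nonerasing) random context grammar with terminal alphabet $T$. -/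

import Mathlib

/-- `alph w`: the set of all symbols occurring in the string `w`. -/
def alph {α : Type*} (w : List α) : Set α := {s | s ∈ w}

/-- A production `(A → x, Per, For)` with terminals from `T` and nonterminals from `N`.
`Symbol T N` is the disjoint union of the two alphabets. -/
structure RandomContextRule (T N : Type*) where
  /-- the left-hand side `A` -/
  input : N
  /-- the right-hand side `x` -/
  output : List (Symbol T N)
  /-- the permitting set `Per` -/
  per : Set N
  /-- the forbidding set `For` -/
  forb : Set N

/-- A (nonerasing) random context grammar with terminal alphabet `T`: a finite set of nonterminals,
a start symbol, and finitely many productions, all with nonempty right-hand sides. -/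
structure RandomContextGrammar (T : Type*) where
  /-- the nonterminals -/
  NT : Type
  finite_NT : Finite NT
  /-- the start symbol -/
  initial : NT
  /-- the productions -/
  rules : Set (RandomContextRule T NT)
  finite_rules : rules.Finite
  nonerasing : ∀ r ∈ rules, r.output ≠ []

namespace RandomContextGrammar

variable {T : Type*}

/-- The direct derivation step `uAv ⇒ uxv` by a production `(A → x, Per, For)`, which requires
`Per ⊆ alph (uv)` and `alph (uv) ∩ For = ∅`; the rewritten occurrence of `A` is not considered. -/
def Produces (G : RandomContextGrammar T) (y z : List (Symbol T G.NT)) : Prop :=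
  ∃ r ∈ G.rules, ∃ u v : List (Symbol T G.NT),
    y = u ++ [Symbol.nonterminal r.input] ++ v ∧
    z = u ++ r.output ++ v ∧
    Symbol.nonterminal '' r.per ⊆ alph (u ++ v) ∧
    alph (u ++ v) ∩ Symbol.nonterminal '' r.forb = ∅

/-- The reflexive and transitive closure of the direct derivation step. -/
def Derives (G : RandomContextGrammar T) :
    List (Symbol T G.NT) → List (Symbol T G.NT) → Prop :=
  Relation.ReflTransGen G.Produces

/-- The language generated by `G`: all terminal strings derivable from the start symbol. -/
def language (G : RandomContextGrammar T) : Language T :=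
  {w : List T | G.Derives [Symbol.nonterminal G.initial] (w.map Symbol.terminal)}

/-- Every production has one of the forms `(A → BC, Per, For)`, `(A → B, Per, For)`,
`(A → a, ∅, ∅)`, with nonterminals `A`, `B`, `C` and a terminal `a`. -/
def IsProductionLimited (G : RandomContextGrammar T) : Prop :=
  ∀ r ∈ G.rules,
    (∃ B C : G.NT, r.output = [Symbol.nonterminal B, Symbol.nonterminal C]) ∨
    (∃ B : G.NT, r.output = [Symbol.nonterminal B]) ∨
    (∃ a : T, r.output = [Symbol.terminal a] ∧ r.per = ∅ ∧ r.forb = ∅)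

/-- Production-limited, and every permitting and every forbidding set is empty or a singleton. -/
def IsLimited (G : RandomContextGrammar T) : Prop :=
  G.IsProductionLimited ∧
    ∀ r ∈ G.rules, (r.per = ∅ ∨ ∃ X, r.per = {X}) ∧ (r.forb = ∅ ∨ ∃ X, r.forb = {X})

end RandomContextGrammar

/-- A random context language is a language generated by a random context grammar. -/
def IsRandomContextLanguage {T : Type*} (L : Language T) : Prop :=
  ∃ G : RandomContextGrammar T, G.language = L

/-! The sets `Per` and `For` are tested one symbol at a time, so the whole simulation of a
production has to run without interference. For this, every symbol of `G`, terminals included, gets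
a nonterminal copy `plain`, and a single control symbol holds the right to act. A leader picks a
production with its left-hand side, performs the tests one by one, then emits the right-hand side
symbol by symbol; the last emitted symbol becomes the new leader. Since all other nonterminals are
`plain` meanwhile, the tests see exactly the context of the rewritten occurrence.

Leadership moves by a handshake with singleton conditions: `give x y` permits one `recv x y`, whose
presence permits `give` to retire, whose absence in turn lets `recv` lead.

Soundness is the invariant `Inv.step`. A `work` symbol is decoded as the output it has still to
emit, so reachability in `G` is then claimed only on condition that the remaining tests succeed.
Completeness combines `steps_led_led`, which moves the leader to the next occurrence to be
rewritten, with `steps_led_of_rule`. -/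

namespace LimitedRandomContext

open RandomContextGrammar

/-! ### The limited grammar -/

/-- Nonterminals of the limited grammar. Every sentential form contains at most one thread of
control; `lead` marks the symbol holding it, `give` and `recv` hand it over to another symbol,
and `work P F o` still has to test `P` and `F` before it emits `o`. -/
inductive Ctl (N K : Type) (B : ℕ)
  | plain (k : K)
  | lead (k : K)
  | give (x y : K)
  | recv (x y : K)
  | work (P F : Set N) (o : {o : List K // o.length ≤ B})

open Ctl

instance {N K : Type} {B : ℕ} [Finite N] [Finite K] : Finite (Ctl N K B) := by
  have : Finite {o : List K // o.length ≤ B} := (List.finite_length_le K B).to_subtype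
  let f : K ⊕ K ⊕ (K × K) ⊕ (K × K) ⊕ (Set N × Set N × {o : List K // o.length ≤ B}) →
      Ctl N K B :=
    Sum.elim plain <| Sum.elim lead <| Sum.elim (fun p => give p.1 p.2) <|
      Sum.elim (fun p => recv p.1 p.2) (fun p => work p.1 p.2.1 p.2.2)
  refine Finite.of_surjective f ?_
  rintro (k | k | ⟨x, y⟩ | ⟨x, y⟩ | ⟨P, F, o⟩)
  · exact ⟨.inl k, rfl⟩
  · exact ⟨.inr (.inl k), rfl⟩
  · exact ⟨.inr (.inr (.inl (x, y))), rfl⟩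
  · exact ⟨.inr (.inr (.inr (.inl (x, y)))), rfl⟩
  · exact ⟨.inr (.inr (.inr (.inr (P, F, o)))), rfl⟩

universe u

variable {T : Type u}

/-- The productions of the limited grammar. -/
inductive IsRule (G : RandomContextGrammar T) {K : Type} (e : Symbol T G.NT ≃ K) (B : ℕ) :
    RandomContextRule T (Ctl G.NT K B) → Prop
  | start (r) (hr : r ∈ G.rules) (o) (ho : o.1 = r.output.map e) :
      IsRule G e B ⟨lead (e (.nonterminal r.input)), [.nonterminal (work r.per r.forb o)], ∅, ∅⟩
  | per (P P' F o p) (h : P ⊆ insert p P') :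
      IsRule G e B
        ⟨work P F o, [.nonterminal (work P' F o)], {plain (e (.nonterminal p))}, ∅⟩
  | forb (P F F' o p) (h : F ⊆ insert p F') :
      IsRule G e B
        ⟨work P F o, [.nonterminal (work P F' o)], ∅, {plain (e (.nonterminal p))}⟩
  | emit (o o' k) (h : o.1 = k :: o'.1) :
      IsRule G e B
        ⟨work ∅ ∅ o, [.nonterminal (plain k), .nonterminal (work ∅ ∅ o')], ∅, ∅⟩
  | last (o k) (h : o.1 = [k]) :
      IsRule G e B ⟨work ∅ ∅ o, [.nonterminal (lead k)], ∅, ∅⟩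
  | offer (x y) : IsRule G e B ⟨lead x, [.nonterminal (give x y)], ∅, ∅⟩
  | claim (x y) : IsRule G e B ⟨plain y, [.nonterminal (recv x y)], {give x y}, {recv x y}⟩
  | release (x y) : IsRule G e B ⟨give x y, [.nonterminal (plain x)], {recv x y}, ∅⟩
  | takeover (x y) : IsRule G e B ⟨recv x y, [.nonterminal (lead y)], ∅, {give x y}⟩
  | term (a) : IsRule G e B ⟨plain (e (.terminal a)), [.terminal a], ∅, ∅⟩
  | termLead (a) : IsRule G e B ⟨lead (e (.terminal a)), [.terminal a], ∅, ∅⟩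

theorem finite_setOf_output_length_le {N : Type} [Finite T] [Finite N] (n : ℕ) :
    {r : RandomContextRule T N | r.output.length ≤ n}.Finite := by
  have : Finite (Symbol T N) := by
    refine Finite.of_surjective (Sum.elim Symbol.terminal Symbol.nonterminal : T ⊕ N → _) ?_
    rintro (a | A)
    · exact ⟨.inl a, rfl⟩
    · exact ⟨.inr A, rfl⟩
  have : Finite {o : List (Symbol T N) // o.length ≤ n} :=
    (List.finite_length_le _ n).to_subtype
  let f : N × {o : List (Symbol T N) // o.length ≤ n} × Set N × Set N → RandomContextRule T N :=
    fun p => ⟨p.1, p.2.1, p.2.2.1, p.2.2.2⟩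
  refine (Set.finite_range f).subset ?_
  rintro ⟨A, o, P, F⟩ h
  exact ⟨(A, ⟨o, h⟩, P, F), rfl⟩

section

variable {G : RandomContextGrammar T} {K : Type} {e : Symbol T G.NT ≃ K} {B : ℕ}

variable (G e B) in
/-- The limited grammar simulating `G`. -/
def grammar [Finite T] [Finite K] : RandomContextGrammar T where
  NT := Ctl G.NT K B
  finite_NT := by
    have := G.finite_NT
    infer_instance
  initial := lead (e (.nonterminal G.initial))
  rules := {r | IsRule G e B r}
  finite_rules := by
    have := G.finite_NT
    refine (finite_setOf_output_length_le 2).subset ?_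
    rintro _ (_ | _ | _ | _ | _ | _ | _ | _ | _ | _ | _) <;> simp
  nonerasing := by
    rintro _ (_ | _ | _ | _ | _ | _ | _ | _ | _ | _ | _) <;> simp

theorem IsRule.isLimited {r : RandomContextRule T (Ctl G.NT K B)} (h : IsRule G e B r) :
    ((∃ X Y, r.output = [.nonterminal X, .nonterminal Y]) ∨ (∃ X, r.output = [.nonterminal X]) ∨
      ∃ a, r.output = [.terminal a] ∧ r.per = ∅ ∧ r.forb = ∅) ∧
    (r.per = ∅ ∨ ∃ X, r.per = {X}) ∧ (r.forb = ∅ ∨ ∃ X, r.forb = {X}) := by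
  cases h <;> simp

theorem isLimited_grammar [Finite T] [Finite K] : (grammar G e B).IsLimited :=
  ⟨fun _ h => (IsRule.isLimited h).1, fun _ h => (IsRule.isLimited h).2⟩

/-! ### Soundness: the invariant of the single control thread -/

/-- Strings over the nonterminals of the limited grammar. -/
abbrev Form (G : RandomContextGrammar T) (K : Type) (B : ℕ) := List (Symbol T (Ctl G.NT K B))

/-- The control symbols in a sentential form. -/
def ctl : Form G K B → Multiset (Ctl G.NT K B)
  | [] => 0
  | .terminal _ :: y => ctl y
  | .nonterminal (plain _) :: y => ctl y
  | .nonterminal s :: y => s ::ₘ ctl y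

theorem ctl_append (u v : Form G K B) : ctl (u ++ v) = ctl u + ctl v := by
  induction u using ctl.induct <;> simp_all [ctl]

theorem mem_of_mem_ctl {y : Form G K B} {s : Ctl G.NT K B} (h : s ∈ ctl y) :
    .nonterminal s ∈ y := by
  induction y using ctl.induct <;> simp_all [ctl]; tauto

theorem mem_ctl {y : Form G K B} {s : Ctl G.NT K B} (hs : ∀ k, s ≠ plain k)
    (h : .nonterminal s ∈ y) : s ∈ ctl y := by
  induction y using ctl.induct <;> simp_all [ctl]; tauto

/-- The string of `G` represented by a symbol of the limited grammar. -/
def decode (e : Symbol T G.NT ≃ K) : Symbol T (Ctl G.NT K B) → List (Symbol T G.NT)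
  | .terminal a => [.terminal a]
  | .nonterminal (plain k) => [e.symm k]
  | .nonterminal (lead k) => [e.symm k]
  | .nonterminal (give x _) => [e.symm x]
  | .nonterminal (recv _ y) => [e.symm y]
  | .nonterminal (work _ _ o) => o.1.map e.symm

/-- The string represented by `y` is a sentential form of `G`. -/
def Reach (e : Symbol T G.NT ≃ K) (y : Form G K B) : Prop :=
  G.Derives [.nonterminal G.initial] (y.flatMap (decode e))

/-- The invariant of derivations in the limited grammar. -/
inductive Inv (e : Symbol T G.NT ≃ K) (y : Form G K B) : Prop
  | done (hc : ctl y = 0) (h : Reach e y)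
  | lead (k) (hc : ctl y = {.lead k}) (h : Reach e y)
  | give (x z) (hc : ctl y = {.give x z}) (h : Reach e y)
  | both (x z) (hc : ctl y = {.give x z, .recv x z}) (h : Reach e y)
  | recv (x z) (hc : ctl y = {.recv x z}) (h : Reach e y)
  | work (P F o) (hc : ctl y = {.work P F o})
      (h : (∀ p ∈ P, .nonterminal (plain (e (.nonterminal p))) ∈ y) →
        (∀ p ∈ F, .nonterminal (plain (e (.nonterminal p))) ∉ y) → Reach e y)

theorem mem_flatMap_decode {y : Form G K B} {A : G.NT}
    (h : .nonterminal (plain (e (.nonterminal A))) ∈ y) :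
    .nonterminal A ∈ y.flatMap (decode e) :=
  List.mem_flatMap.2 ⟨_, h, by simp [decode]⟩

/-- Without `hc` the symbol `A` could be hidden in a control symbol, invisible to a test for its
`plain` copy. This is what makes forbidding tests reliable. -/
theorem mem_of_mem_flatMap_decode {y : Form G K B} {A : G.NT} (hc : ctl y = 0)
    (h : .nonterminal A ∈ y.flatMap (decode e)) :
    .nonterminal (plain (e (.nonterminal A))) ∈ y := by
  obtain ⟨s, hs, hA⟩ := List.mem_flatMap.1 h
  have key : ∀ t, .nonterminal t ∈ y → ∃ k, t = plain k := by
    intro t ht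
    by_contra hn
    push Not at hn
    simpa [hc] using mem_ctl hn ht
  rcases s with a | t
  · simp [decode] at hA
  · obtain ⟨k, rfl⟩ := key t hs
    simp only [decode, List.mem_singleton] at hA
    simpa [hA] using hs

theorem Reach.congr {y z : Form G K B} (h : Reach e y)
    (hyz : y.flatMap (decode e) = z.flatMap (decode e)) : Reach e z := by
  rwa [Reach, ← hyz]

theorem ctl_middle (u w v : Form G K B) : ctl (u ++ w ++ v) = ctl w + ctl (u ++ v) := by
  simp only [ctl_append]
  abel

theorem Reach.replace {u v w w' : Form G K B} (h : Reach e (u ++ w ++ v))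
    (hw : w.flatMap (decode e) = w'.flatMap (decode e)) : Reach e (u ++ w' ++ v) :=
  h.congr (by simp [hw])

/-- A visible control symbol rules out all shapes of the invariant but those containing it; this and
the next three lemmas invert `Inv` accordingly. -/
theorem Inv.of_lead {u v : Form G K B} {k : K} (h : Inv e (u ++ [.nonterminal (.lead k)] ++ v)) :
    ctl (u ++ v) = 0 ∧ Reach e (u ++ [.nonterminal (.lead k)] ++ v) := by
  have hm : .lead k ∈ ctl (u ++ [.nonterminal (.lead k)] ++ v) := by
    simp [-List.append_assoc, ctl_middle, ctl]
  rcases h with ⟨hc, h⟩ | ⟨_, hc, h⟩ | ⟨_, _, hc, h⟩ | ⟨_, _, hc, h⟩ | ⟨_, _, hc, h⟩ |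
      ⟨_, _, _, hc, h⟩ <;> rw [hc] at hm <;> simp at hm
  subst hm
  rw [ctl_middle] at hc
  exact ⟨add_eq_left.1 hc, h⟩

theorem Inv.of_work {u v : Form G K B} {P F : Set G.NT} {o : {o : List K // o.length ≤ B}}
    (h : Inv e (u ++ [.nonterminal (.work P F o)] ++ v)) :
    ctl (u ++ v) = 0 ∧ ((∀ p ∈ P, .nonterminal (plain (e (.nonterminal p))) ∈ u ++ v) →
      (∀ p ∈ F, .nonterminal (plain (e (.nonterminal p))) ∉ u ++ v) →
      Reach e (u ++ [.nonterminal (.work P F o)] ++ v)) := by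
  have hm : .work P F o ∈ ctl (u ++ [.nonterminal (.work P F o)] ++ v) := by
    simp [-List.append_assoc, ctl_middle, ctl]
  rcases h with ⟨hc, h⟩ | ⟨_, hc, h⟩ | ⟨_, _, hc, h⟩ | ⟨_, _, hc, h⟩ | ⟨_, _, hc, h⟩ |
      ⟨_, _, _, hc, h⟩ <;> rw [hc] at hm <;> simp at hm
  obtain ⟨rfl, rfl, rfl⟩ := hm
  rw [ctl_middle] at hc
  exact ⟨add_eq_left.1 hc, by simpa using h⟩

theorem Inv.of_give {u v : Form G K B} {x z : K}
    (h : Inv e (u ++ [.nonterminal (.give x z)] ++ v)) :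
    (ctl (u ++ v) = 0 ∨ ctl (u ++ v) = {.recv x z}) ∧
      Reach e (u ++ [.nonterminal (.give x z)] ++ v) := by
  have hm : .give x z ∈ ctl (u ++ [.nonterminal (.give x z)] ++ v) := by
    simp [-List.append_assoc, ctl_middle, ctl]
  rcases h with ⟨hc, h⟩ | ⟨_, hc, h⟩ | ⟨_, _, hc, h⟩ | ⟨_, _, hc, h⟩ | ⟨_, _, hc, h⟩ |
      ⟨_, _, _, hc, h⟩ <;> rw [hc] at hm <;> simp at hm <;> obtain ⟨rfl, rfl⟩ := hm <;>
    rw [ctl_middle] at hc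
  · exact ⟨.inl (add_eq_left.1 hc), h⟩
  · exact ⟨.inr (by simpa [ctl] using hc), h⟩

theorem Inv.of_recv {u v : Form G K B} {x z : K}
    (h : Inv e (u ++ [.nonterminal (.recv x z)] ++ v)) :
    (ctl (u ++ v) = 0 ∨ ctl (u ++ v) = {.give x z}) ∧
      Reach e (u ++ [.nonterminal (.recv x z)] ++ v) := by
  have hm : .recv x z ∈ ctl (u ++ [.nonterminal (.recv x z)] ++ v) := by
    simp [-List.append_assoc, ctl_middle, ctl]
  rcases h with ⟨hc, h⟩ | ⟨_, hc, h⟩ | ⟨_, _, hc, h⟩ | ⟨_, _, hc, h⟩ | ⟨_, _, hc, h⟩ |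
      ⟨_, _, _, hc, h⟩ <;> rw [hc] at hm <;> simp at hm <;> obtain ⟨rfl, rfl⟩ := hm <;>
    rw [ctl_middle] at hc
  · rw [Multiset.insert_eq_cons, ← Multiset.singleton_add, add_comm {Ctl.give _ _}] at hc
    exact ⟨.inr (by simpa [ctl] using hc), h⟩
  · exact ⟨.inl (add_eq_left.1 hc), h⟩

/-- Once all tests have succeeded, a production of `G` can be applied. -/
theorem Reach.apply_rule {u v : Form G K B} {r : RandomContextRule T G.NT} (hr : r ∈ G.rules)
    {o : {o : List K // o.length ≤ B}} (ho : o.1 = r.output.map e) (hc : ctl (u ++ v) = 0)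
    (h : Reach e (u ++ [.nonterminal (lead (e (.nonterminal r.input)))] ++ v))
    (hP : ∀ p ∈ r.per, .nonterminal (plain (e (.nonterminal p))) ∈ u ++ v)
    (hF : ∀ p ∈ r.forb, .nonterminal (plain (e (.nonterminal p))) ∉ u ++ v) :
    Reach e (u ++ [.nonterminal (work r.per r.forb o)] ++ v) := by
  -- The symbol `work r.per r.forb o` decodes to the full right-hand side, so the step of `G` is
  -- counted here, before any test is made.
  refine Relation.ReflTransGen.tail h
    ⟨r, hr, u.flatMap (decode e), v.flatMap (decode e), by simp [decode],
      by simp [decode, ho], ?_, ?_⟩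
  · rintro _ ⟨p, hp, rfl⟩
    rw [← List.flatMap_append]
    exact mem_flatMap_decode (hP p hp)
  · rw [Set.eq_empty_iff_forall_notMem]
    rintro _ ⟨h1, p, hp, rfl⟩
    rw [← List.flatMap_append] at h1
    exact hF p hp (mem_of_mem_flatMap_decode hc h1)

/-- The invariant is preserved by every production. -/
theorem Inv.step {r : RandomContextRule T (Ctl G.NT K B)} (hr : IsRule G e B r)
    {u v : Form G K B} (h : Inv e (u ++ [.nonterminal r.input] ++ v))
    (hper : ∀ s ∈ r.per, .nonterminal s ∈ u ++ v)
    (hforb : ∀ s ∈ r.forb, .nonterminal s ∉ u ++ v) : Inv e (u ++ r.output ++ v) := by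
  cases hr with
  | start r hr o ho =>
    obtain ⟨hc, h⟩ := h.of_lead
    refine .work _ _ _ (by rw [ctl_middle, hc]; rfl) fun hP hF => h.apply_rule hr ho hc ?_ ?_
    · simpa using hP
    · simpa using hF
  | per P P' F o p hP =>
    obtain ⟨hc, h⟩ := h.of_work
    refine .work _ _ _ (by rw [ctl_middle, hc]; rfl) fun h1 h2 => (h ?_ ?_).replace rfl
    · intro q hq
      -- The test just made accounts for `p`; any other element of `P` lies in `P'` and is covered
      -- by the remaining tests.
      rcases hP hq with rfl | hq
      · exact hper _ rfl
      · simpa using h1 q hq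
    · simpa using h2
  | forb P F F' o p hF =>
    obtain ⟨hc, h⟩ := h.of_work
    refine .work _ _ _ (by rw [ctl_middle, hc]; rfl) fun h1 h2 => (h ?_ ?_).replace rfl
    · simpa using h1
    · intro q hq
      rcases hF hq with rfl | hq
      · exact hforb _ rfl
      · simpa using h2 q hq
  | emit o o' k ho =>
    obtain ⟨hc, h⟩ := h.of_work
    exact .work _ _ _ (by rw [ctl_middle, hc]; rfl) fun _ _ =>
      (h (by simp) (by simp)).replace (by simp [decode, ho])
  | last o k ho =>
    obtain ⟨hc, h⟩ := h.of_work
    exact .lead _ (by rw [ctl_middle, hc]; rfl)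
      ((h (by simp) (by simp)).replace (by simp [decode, ho]))
  | offer x y =>
    obtain ⟨hc, h⟩ := h.of_lead
    exact .give _ _ (by rw [ctl_middle, hc]; rfl) (h.replace rfl)
  | claim x y =>
    have hg := mem_ctl (by simp) (hper _ rfl)
    -- The forbidding set excludes a second receiver, so the form contains `give x y` alone.
    have hr : .recv x y ∉ ctl (u ++ v) := fun h1 => hforb _ rfl (mem_of_mem_ctl h1)
    rcases h with ⟨hc, h⟩ | ⟨_, hc, h⟩ | ⟨_, _, hc, h⟩ | ⟨_, _, hc, h⟩ | ⟨_, _, hc, h⟩ |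
      ⟨_, _, _, hc, h⟩ <;> rw [ctl_middle, ctl, ctl, zero_add] at hc <;> simp [hc] at hg hr
    · obtain ⟨rfl, rfl⟩ := hg
      refine .both x y ?_ (h.replace rfl)
      rw [ctl_middle, hc, Multiset.insert_eq_cons, ← Multiset.singleton_add,
        add_comm {Ctl.give _ _}]
      rfl
    · exact absurd hg.2 (hr hg.1)
  | release x y =>
    have hm := mem_ctl (by simp) (hper _ rfl)
    obtain ⟨hc | hc, h⟩ := h.of_give
    · simp [hc] at hm
    · exact .recv x y (by rw [ctl_middle, hc]; rfl) (h.replace rfl)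
  | takeover x y =>
    obtain ⟨hc | hc, h⟩ := h.of_recv
    · exact .lead y (by rw [ctl_middle, hc]; rfl) (h.replace rfl)
    · exact absurd (mem_of_mem_ctl (by simp [hc])) (hforb (.give x y) rfl)
  | term a =>
    have hr {y} : Reach e (u ++ [.nonterminal y] ++ v) →
        decode e (.nonterminal y) = [.terminal a] → Reach e (u ++ [.terminal a] ++ v) :=
      fun h h1 => h.replace (by simp only [List.flatMap_singleton, h1]; rfl)
    have hd : decode e (.nonterminal (plain (B := B) (e (.terminal a)))) = [.terminal a] := by
      simp [decode]
    rcases h with ⟨hc, h⟩ | ⟨_, hc, h⟩ | ⟨_, _, hc, h⟩ | ⟨_, _, hc, h⟩ | ⟨_, _, hc, h⟩ |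
      ⟨P, F, o, hc, h⟩ <;> rw [ctl_middle] at hc
    · exact .done (by rw [ctl_middle]; exact hc) (hr h hd)
    · exact .lead _ (by rw [ctl_middle]; exact hc) (hr h hd)
    · exact .give _ _ (by rw [ctl_middle]; exact hc) (hr h hd)
    · exact .both _ _ (by rw [ctl_middle]; exact hc) (hr h hd)
    · exact .recv _ _ (by rw [ctl_middle]; exact hc) (hr h hd)
    · refine .work _ _ _ (by rw [ctl_middle]; exact hc) fun h1 h2 => hr (h ?_ ?_) hd
      · simpa using h1
      · simpa using h2
  | termLead a =>
    obtain ⟨hc, h⟩ := h.of_lead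
    exact .done (by rw [ctl_middle, hc]; rfl) (h.replace (by simp [decode]))

theorem Inv.derives_of_terminals {w : List T} (h : Inv e (w.map .terminal : Form G K B)) :
    G.Derives [.nonterminal G.initial] (w.map .terminal) := by
  have hc : ctl (w.map .terminal : Form G K B) = 0 := by
    clear h
    induction w with
    | nil => rfl
    | cons a w ih => simpa [ctl] using ih
  have hd : (w.map .terminal : Form G K B).flatMap (decode e) = w.map .terminal := by
    rw [List.flatMap_map, List.map_eq_flatMap]
    rfl
  have hR : Reach e (w.map .terminal : Form G K B) := by
    rcases h with ⟨_, h⟩ | ⟨_, h0, h⟩ | ⟨_, _, h0, h⟩ | ⟨_, _, h0, h⟩ | ⟨_, _, h0, h⟩ |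
      ⟨_, _, _, h0, h⟩
    -- Only the `work` case has conditional reachability, and it needs a control symbol.
    on_goal 6 => simp [hc] at h0
    all_goals exact h
  rwa [Reach, hd] at hR

/-! ### Completeness: simulating derivations of `G` -/

/-- The copy of a string of `G` without a leader. -/
def dress (e : Symbol T G.NT ≃ K) (w : List (Symbol T G.NT)) : Form G K B :=
  w.map fun s => .nonterminal (plain (e s))

theorem dress_append (u v : List (Symbol T G.NT)) :
    (dress e (u ++ v) : Form G K B) = dress e u ++ dress e v := List.map_append

theorem nonterminal_mem_dress {w : List (Symbol T G.NT)} {s : Symbol T G.NT} :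
    .nonterminal (plain (e s)) ∈ (dress e w : Form G K B) ↔ s ∈ w := by
  simp [dress]

theorem notMem_dress {w : List (Symbol T G.NT)} {s : Ctl G.NT K B} (hs : ∀ k, s ≠ plain k) :
    .nonterminal s ∉ (dress e w : Form G K B) := by
  simp only [dress, List.mem_map, not_exists, not_and, Symbol.nonterminal.injEq]
  exact fun x _ h => hs _ h.symm

/-- The copy of `u ++ [s] ++ v` whose leader is `s`. -/
def led (e : Symbol T G.NT ≃ K) (u : List (Symbol T G.NT)) (s : Symbol T G.NT)
    (v : List (Symbol T G.NT)) : Form G K B :=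
  dress e u ++ [.nonterminal (lead (e s))] ++ dress e v

theorem initial_reach :
    Reach e ([.nonterminal (lead (e (.nonterminal G.initial)))] : Form G K B) := by
  have : ([.nonterminal (lead (e (.nonterminal G.initial)))] : Form G K B).flatMap (decode e) =
      [.nonterminal G.initial] := by simp [decode]
  rw [Reach, this]
  exact .refl

variable [Finite T] [Finite K]

theorem produces_of_isRule {r : RandomContextRule T (Ctl G.NT K B)} (hr : IsRule G e B r)
    (u v : Form G K B) (hper : ∀ s ∈ r.per, .nonterminal s ∈ u ++ v)
    (hforb : ∀ s ∈ r.forb, .nonterminal s ∉ u ++ v) :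
    (grammar G e B).Produces (u ++ [.nonterminal r.input] ++ v) (u ++ r.output ++ v) := by
  refine ⟨r, hr, u, v, rfl, rfl, ?_, ?_⟩
  · rintro _ ⟨s, hs, rfl⟩
    exact hper s hs
  · rw [Set.eq_empty_iff_forall_notMem]
    rintro _ ⟨h1, s, hs, rfl⟩
    exact hforb s hs h1

theorem inv_of_derives {y : Form G K B}
    (h : (grammar G e B).Derives [.nonterminal (lead (e (.nonterminal G.initial)))] y) :
    Inv e y := by
  induction h with
  | refl => exact .lead _ rfl initial_reach
  | tail _ h ih =>
    obtain ⟨r, hr, u, v, rfl, rfl, hper, hforb⟩ := h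
    refine Inv.step hr ih (fun s hs => hper ⟨s, hs, rfl⟩) fun s hs h1 => ?_
    exact (Set.eq_empty_iff_forall_notMem.1 hforb) _ ⟨h1, s, hs, rfl⟩

variable (e B) in
/-- Derivations of the limited grammar. -/
def Steps (y z : Form G K B) : Prop := (grammar G e B).Derives y z

theorem Steps.refl (y : Form G K B) : Steps e B y y := Relation.ReflTransGen.refl

theorem Steps.trans {x y z : Form G K B} (h : Steps e B x y) (h' : Steps e B y z) : Steps e B x z :=
  Relation.ReflTransGen.trans h h'

theorem steps_of_isRule {r : RandomContextRule T (Ctl G.NT K B)} (hr : IsRule G e B r)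
    (u v : Form G K B) (hper : ∀ s ∈ r.per, .nonterminal s ∈ u ++ v)
    (hforb : ∀ s ∈ r.forb, .nonterminal s ∉ u ++ v) :
    Steps e B (u ++ [.nonterminal r.input] ++ v) (u ++ r.output ++ v) :=
  Relation.ReflTransGen.single (produces_of_isRule hr u v hper hforb)

/-- Finiteness of the nonterminals allows induction on both sets; the context `u`, `v` is unchanged,
so each test can be made separately. -/
theorem steps_tests (u v : Form G K B) (P F : Set G.NT) (o : {o : List K // o.length ≤ B})
    (hP : ∀ p ∈ P, .nonterminal (plain (e (.nonterminal p))) ∈ u ++ v)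
    (hF : ∀ p ∈ F, .nonterminal (plain (e (.nonterminal p))) ∉ u ++ v) :
    Steps e B (u ++ [.nonterminal (work P F o)] ++ v)
      (u ++ [.nonterminal (work ∅ ∅ o)] ++ v) := by
  have := G.finite_NT
  have hF' : Steps e B (u ++ [.nonterminal (work ∅ F o)] ++ v)
      (u ++ [.nonterminal (work ∅ ∅ o)] ++ v) := by
    induction F, F.toFinite using Set.Finite.induction_on with
    | empty => exact .refl _
    | @insert p F _ _ ih =>
      refine (steps_of_isRule (.forb ∅ (insert p F) F o p subset_rfl) u v (by simp) ?_).trans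
        (ih fun q hq => hF q (.inr hq))
      rintro _ rfl
      exact hF p (.inl rfl)
  induction P, P.toFinite using Set.Finite.induction_on with
  | empty => exact hF'
  | @insert p P _ _ ih =>
    refine (steps_of_isRule (.per (insert p P) P F o p subset_rfl) u v ?_ (by simp)).trans
      (ih fun q hq => hP q (.inr hq))
    rintro _ rfl
    exact hP p (.inl rfl)

theorem steps_emit (l : List K) (k : K) (u v : Form G K B) (o : {o : List K // o.length ≤ B})
    (ho : o.1 = l ++ [k]) :
    Steps e B (u ++ [.nonterminal (work ∅ ∅ o)] ++ v)
      (u ++ l.map (fun k => .nonterminal (plain k)) ++ [.nonterminal (lead k)] ++ v) := by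
  induction l generalizing u o with
  | nil => simpa using steps_of_isRule (e := e) (.last o k ho) u v (by simp) (by simp)
  | cons a l ih =>
    have hlen : (l ++ [k]).length ≤ B := by
      have := o.2
      rw [ho] at this
      simp at this ⊢
      omega
    have h1 := steps_of_isRule (e := e) (.emit o ⟨l ++ [k], hlen⟩ a ho) u v (by simp) (by simp)
    have h2 := ih (u ++ [.nonterminal (plain a)]) ⟨l ++ [k], hlen⟩ rfl
    simp only [List.append_assoc, List.cons_append, List.nil_append, List.map_cons] at h1 h2 ⊢
    exact h1.trans h2

theorem steps_led_of_rule {r : RandomContextRule T G.NT} (hr : r ∈ G.rules)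
    (hB : r.output.length ≤ B) {x : List (Symbol T G.NT)} {s : Symbol T G.NT}
    (hx : r.output = x ++ [s]) {u v : List (Symbol T G.NT)}
    (hP : Symbol.nonterminal '' r.per ⊆ alph (u ++ v))
    (hF : alph (u ++ v) ∩ Symbol.nonterminal '' r.forb = ∅) :
    Steps e B (led e u (.nonterminal r.input) v) (led e (u ++ x) s v) := by
  have ho : (r.output.map e).length ≤ B := by simpa using hB
  have h1 := steps_of_isRule (.start r hr ⟨_, ho⟩ rfl) (dress e u) (dress e v)
    (by simp) (by simp)
  have h2 := steps_tests (e := e) (dress e u) (dress e v) r.per r.forb ⟨_, ho⟩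
    (fun p hp => by
      rw [← dress_append, nonterminal_mem_dress]
      exact hP ⟨p, hp, rfl⟩)
    (fun p hp h => by
      rw [← dress_append, nonterminal_mem_dress] at h
      exact Set.eq_empty_iff_forall_notMem.1 hF _ ⟨h, p, hp, rfl⟩)
  have h3 := steps_emit (e := e) (x.map e) (e s) (dress e u) (dress e v) ⟨_, ho⟩
    (by simp [hx])
  have h := (h1.trans h2).trans h3
  simpa [led, dress, Function.comp_def] using h

/-- One round of the handshake. The hypothesis `hc` excludes stray control symbols, which could
block `claim` or `takeover`. -/
theorem steps_handover (c₁ c₂ c₃ : Form G K B) (x y : K)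
    (hc : ∀ s : Ctl G.NT K B, (∀ k, s ≠ plain k) → .nonterminal s ∉ c₁ ++ c₂ ++ c₃) :
    Steps e B
      (c₁ ++ [.nonterminal (lead x)] ++ c₂ ++ [.nonterminal (plain y)] ++ c₃)
      (c₁ ++ [.nonterminal (plain x)] ++ c₂ ++ [.nonterminal (lead y)] ++ c₃) := by
  have hg := hc (give x y) (by simp)
  have hr := hc (recv x y) (by simp)
  have h1 := steps_of_isRule (e := e) (.offer x y) c₁ (c₂ ++ [.nonterminal (plain y)] ++ c₃)
    (by simp) (by simp)
  have h2 := steps_of_isRule (e := e) (.claim x y) (c₁ ++ [.nonterminal (give x y)] ++ c₂) c₃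
    (by simp) (by simpa using hr)
  have h3 := steps_of_isRule (e := e) (.release x y) c₁ (c₂ ++ [.nonterminal (recv x y)] ++ c₃)
    (by simp) (by simp)
  have h4 := steps_of_isRule (e := e) (.takeover x y) (c₁ ++ [.nonterminal (plain x)] ++ c₂) c₃
    (by simp) (by simpa using hg)
  simp only [List.append_assoc] at h1 h2 h3 h4 ⊢
  exact ((h1.trans h2).trans h3).trans h4

theorem steps_handover_left (c₁ c₂ c₃ : Form G K B) (x y : K)
    (hc : ∀ s : Ctl G.NT K B, (∀ k, s ≠ plain k) → .nonterminal s ∉ c₁ ++ c₂ ++ c₃) :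
    Steps e B
      (c₁ ++ [.nonterminal (plain y)] ++ c₂ ++ [.nonterminal (lead x)] ++ c₃)
      (c₁ ++ [.nonterminal (lead y)] ++ c₂ ++ [.nonterminal (plain x)] ++ c₃) := by
  have hg := hc (give x y) (by simp)
  have hr := hc (recv x y) (by simp)
  have h1 := steps_of_isRule (e := e) (.offer x y) (c₁ ++ [.nonterminal (plain y)] ++ c₂) c₃
    (by simp) (by simp)
  have h2 := steps_of_isRule (e := e) (.claim x y) c₁ (c₂ ++ [.nonterminal (give x y)] ++ c₃)
    (by simp) (by simpa using hr)
  have h3 := steps_of_isRule (e := e) (.release x y) (c₁ ++ [.nonterminal (recv x y)] ++ c₂) c₃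
    (by simp) (by simp)
  have h4 := steps_of_isRule (e := e) (.takeover x y) c₁ (c₂ ++ [.nonterminal (plain x)] ++ c₃)
    (by simp) (by simpa using hg)
  simp only [List.append_assoc] at h1 h2 h3 h4 ⊢
  exact ((h1.trans h2).trans h3).trans h4

/-- Leadership can be moved to any position. -/
theorem steps_led_led {u v u' v' : List (Symbol T G.NT)} {s s' : Symbol T G.NT}
    (h : u ++ [s] ++ v = u' ++ [s'] ++ v') :
    Steps e B (led e u s v) (led e u' s' v') := by
  have hn (a b c : List (Symbol T G.NT)) (t : Ctl G.NT K B) (ht : ∀ k, t ≠ plain k) :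
      .nonterminal t ∉ (dress e a ++ dress e b ++ dress e c : Form G K B) := by
    rw [← dress_append, ← dress_append]
    exact notMem_dress ht
  simp only [List.append_assoc, List.singleton_append] at h
  -- Either the two positions coincide (`m` is empty), or one marked symbol is strictly to the left
  -- of the other and a single handover suffices.
  rcases List.append_eq_append_iff.1 h with ⟨m, h1, h2⟩ | ⟨m, h1, h2⟩
  · rcases m with _ | ⟨t, m⟩
    · simp at h1 h2
      obtain ⟨rfl, rfl⟩ := h2
      subst h1
      exact .refl _
    · obtain ⟨rfl, rfl⟩ := by simpa using h2
      subst h1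
      have := steps_handover (e := e) _ _ _ (e s) (e s') (hn u m v')
      simpa [led, dress] using this
  · rcases m with _ | ⟨t, m⟩
    · simp at h1 h2
      obtain ⟨rfl, rfl⟩ := h2
      subst h1
      exact .refl _
    · obtain ⟨rfl, rfl⟩ := by simpa using h2
      subst h1
      have := steps_handover_left (e := e) _ _ _ (e s) (e s') (hn u' m v)
      simpa [led, dress] using this

/-- Some leader position is enough, since leadership can be moved before the next production.
Nonerasingness supplies the last output symbol that inherits it. -/
theorem steps_led_of_derives (hB : ∀ r ∈ G.rules, r.output.length ≤ B)
    {w : List (Symbol T G.NT)} (h : G.Derives [.nonterminal G.initial] w) :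
    ∃ u s v, w = u ++ [s] ++ v ∧ Steps e B
      [.nonterminal (lead (e (.nonterminal G.initial)))] (led e u s v) := by
  induction h with
  | refl => exact ⟨[], _, [], rfl, .refl _⟩
  | tail _ h ih =>
    obtain ⟨r, hr, u, v, rfl, rfl, hP, hF⟩ := h
    obtain ⟨u₀, s₀, v₀, h0, hd⟩ := ih
    obtain ⟨x, s, hx⟩ := (List.eq_nil_or_concat' r.output).resolve_left (G.nonerasing r hr)
    exact ⟨u ++ x, s, v, by simp [hx],
      (hd.trans (steps_led_led h0.symm)).trans (steps_led_of_rule hr (hB r hr) hx hP hF)⟩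

theorem steps_terminals (w : List T) (u v : Form G K B) :
    Steps e B (u ++ dress e (w.map .terminal) ++ v)
      (u ++ w.map .terminal ++ v) := by
  induction w generalizing u with
  | nil => exact .refl _
  | cons a w ih =>
    have h1 := steps_of_isRule (e := e) (.term a) u (dress e (w.map .terminal) ++ v) (by simp) (by simp)
    have h2 := ih (u ++ [.terminal a])
    simp [dress] at h1 h2 ⊢
    exact h1.trans h2

theorem steps_of_led {w : List T} {u v : List (Symbol T G.NT)} {s : Symbol T G.NT}
    (h : w.map .terminal = u ++ [s] ++ v) :
    Steps e B (led e u s v) (w.map .terminal) := by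
  obtain ⟨w, v, rfl, hw, rfl⟩ := List.map_eq_append_iff.1 h
  obtain ⟨u, s, rfl, rfl, hs⟩ := List.map_eq_append_iff.1 hw
  obtain ⟨a, rfl, rfl⟩ := List.map_eq_singleton_iff.1 hs
  have h1 := steps_of_isRule (e := e) (.termLead a) (dress e (u.map .terminal) : Form G K B)
    (dress e (v.map .terminal)) (by simp) (by simp)
  have h2 := steps_terminals (e := e) u ([] : Form G K B)
    ([.terminal a] ++ dress e (v.map .terminal))
  have h3 := steps_terminals (e := e) v (u.map .terminal ++ [.terminal a] : Form G K B) []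
  simp at h1 h2 h3 ⊢
  simpa [led] using (h1.trans h2).trans h3

theorem language_grammar (hB : ∀ r ∈ G.rules, r.output.length ≤ B) :
    (grammar G e B).language = G.language := by
  ext w
  constructor
  · exact fun h => (inv_of_derives h).derives_of_terminals
  · intro h
    obtain ⟨u, s, v, hw, hd⟩ := steps_led_of_derives (e := e) hB h
    exact hd.trans (steps_of_led hw)

end

end LimitedRandomContext

open LimitedRandomContext in
theorem mainTheorem5 {T : Type*} [Finite T] (L : Language T)
    (hL : IsRandomContextLanguage L) :
    ∃ G : RandomContextGrammar T, G.IsLimited ∧ G.language = L := by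
  obtain ⟨G, rfl⟩ := hL
  have := G.finite_NT
  obtain ⟨n, ⟨f⟩⟩ := Finite.exists_equiv_fin T
  -- Nonterminals must live in `Type`, whereas `T` may lie in a higher universe; `Fin n` stands in
  -- for `T`.
  let e : Symbol T G.NT ≃ Fin n ⊕ G.NT :=
    { toFun := fun
        | .terminal a => .inl (f a)
        | .nonterminal A => .inr A
      invFun := Sum.elim (fun i => .terminal (f.symm i)) .nonterminal
      left_inv := by rintro (a | A) <;> simp
      right_inv := by rintro (i | A) <;> simp }
  -- A common bound on the right-hand sides keeps the set of `work` symbols finite.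
  obtain ⟨B, hB⟩ := (G.finite_rules.image fun r => r.output.length).bddAbove
  exact ⟨grammar G e B, isLimited_grammar,
    language_grammar fun r hr => hB ⟨r, hr, rfl⟩⟩
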